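/- **Setting.** Let $d,p\ge 1$, let $\mathcal S^{d-1}$ be the unit sphere of $\mathbb R^d$, and let $d\theta$ be the uniform (rotation invariant) surface measure on $\mathcal S^{d-1}$, normalised so that $dx=r^{d-1}\,dr\,d\theta$ in polar coordinates (counting measure on $\{-1,1\}$ if $d=1$). Let $\mu=[\mu_{jk}]$ be a finite measure on $\mathcal S^{d-1}$ whose values are positive semidefinite complex $p\times p$ matrices, Hermitian in the sense that $\mu(-A)=\overline{\mu(A)}$. Let $B$ be a zero-mean $\mathbb C^p$-valued random measure on $(0,\infty)\times\mathcal S^{d-1}$, defined with square integrable values on the Borel sets of finite control measure, which is Hermitian, $B(\{(r,\theta):(r,-\theta)\in A\})=\overline{B(A)}$ a.s., and has orthogonal increments with control measure $r^{d-1}dr\,\mu(d\theta)$, i.e. $\mathbb E[B(A)B(A')^*]=\int_{A\cap A'} r^{d-1}dr\,\mu(d\theta)$. Let $\varphi:\mathcal S^{d-1}\to\{-1,1\}$ be measurable with $\varphi(-\theta)=-\varphi(\theta)$, let $a_j,\nu_j>0$, and put $\mathbf a=\mathrm{diag}(a_j)$, $\boldsymbol\nu=\mathrm{diag}(\nu_j)$,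 $\mathbf c=\mathrm{diag}(c_j)$. For square matrices let $A^H=\exp(\log(A)H)$, with $\log A=\sum_{n\ge0}\frac{-2}{2n+1}\big((I-A)(I+A)^{-1}\big)^{2n+1}$ when all eigenvalues of $A$ have positive real part. **Proposition 4.1.** Suppose that $\mu_{jj}(d\theta)=\sigma_{jj}\,d\theta$ with $\sigma_{jj}>0$ for $j=1,\dots,p$, and that $$c_j=\frac{a_j^{\nu_j}\sqrt{\Gamma(\nu_j+\frac d2)}}{\pi^{d/4}\sqrt{\Gamma(\nu_j)}},\qquad j=1,\dots,p .$$ Let $Y=(Y_1,\dots,Y_p)$ be a process on $\mathbb R^d$ with the same finite-dimensional distributions as $$s\longmapsto\int_0^\infty\!\int_{\mathcal S^{d-1}}e^{i\langle s,r\theta\rangle}\,\mathbf c\,\big(\mathbf a+\varphi(\theta)\,i\,r\,I_p\big)^{-\boldsymbol\nu-\frac d2 I_p}\,B(dr,d\theta),$$ the stochastic integral being the mean-square limit of the integrals of simple functions. Then, for each $j$, the process $Y_j$ is square integrable with mean zero and has the Matérn covariance with inverse range $a_j$, smoothness $\nu_j$ and variance $\sigma_{jj}$: for all $s,t\in\mathbb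 R^d$, $$\mathbb E\big[Y_j(s)\overline{Y_j(t)}\big]=\sigma_{jj}\,\frac{2^{1-\nu_j}}{\Gamma(\nu_j)}\,\big(a_j\|s-t\|\big)^{\nu_j}\,\mathcal K_{\nu_j}\big(a_j\|s-t\|\big),$$ where $\mathcal K_\nu$ is the modified Bessel function of the second kind, and the right side is read as its limit $\sigma_{jj}$ when $s=t$. -/

import Mathlib

open MeasureTheory ProbabilityTheory Filter Topology
open scoped ComplexConjugate ENNReal

noncomputable section

namespace MaternField

/-- Euclidean space `ℝ^d`. -/
abbrev Space (d : ℕ) : Type := EuclideanSpace ℝ (Fin d)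

/-- The unit sphere of `ℝ^d`. -/
abbrev Sphere (d : ℕ) : Type := Metric.sphere (0 : Space d) 1

/-- Polar coordinates: pairs `(r, θ)` in `(0, ∞) × S^{d-1}`. -/
abbrev Polar (d : ℕ) : Type := Set.Ioi (0 : ℝ) × Sphere d

/-- The uniform (rotation invariant) surface measure `dθ` on the sphere, normalised so that
Lebesgue measure is `r^{d-1} dr dθ` in polar coordinates. For `d = 1` it is the counting measure
on `{-1, 1}`. -/
def surfaceMeasure (d : ℕ) : Measure (Sphere d) :=
  (volume : Measure (Space d)).toSphere

/-! ### Matrix powers -/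

/-- The matrix logarithm, by the Gregory series
`log A = ∑ₙ -2 / (2n+1) ((I - A) (I + A)⁻¹)^(2n+1)`. It converges when all eigenvalues of `A`
have positive real part. -/
def matrixLog {p : ℕ} (A : Matrix (Fin p) (Fin p) ℂ) : Matrix (Fin p) (Fin p) ℂ :=
  ∑' n : ℕ, (-2 / (2 * (n : ℂ) + 1)) • ((1 - A) * (1 + A)⁻¹) ^ (2 * n + 1)

/-- The matrix power `A^H = exp (log A · H)`. -/
def matrixPow {p : ℕ} (A H : Matrix (Fin p) (Fin p) ℂ) : Matrix (Fin p) (Fin p) ℂ :=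
  NormedSpace.exp (matrixLog A * H)

/-! ### Directional measures -/

open scoped ComplexOrder in
/-- A finite Hermitian measure on the sphere with values in the positive semidefinite complex
`p × p` matrices: `σ`-additive, with `μ(-A)` equal to the entrywise conjugate of `μ(A)`. -/
structure DirectionalMeasure (d p : ℕ) where
  toVectorMeasure : VectorMeasure (Sphere d) (Matrix (Fin p) (Fin p) ℂ)
  posSemidef : ∀ A : Set (Sphere d), MeasurableSet A → (toVectorMeasure A).PosSemidef
  hermitian : ∀ A : Set (Sphere d), MeasurableSet A → ∀ j k : Fin p,
    toVectorMeasure (Neg.neg ⁻¹' A) j k = conj (toVectorMeasure A j k)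

namespace DirectionalMeasure

variable {d p : ℕ} (μ : DirectionalMeasure d p)

open scoped ComplexOrder in
theorem trace_re_nonneg (A : Set (Sphere d)) (hA : MeasurableSet A) :
    0 ≤ (μ.toVectorMeasure A).trace.re :=
  (Complex.le_def.1 (μ.posSemidef A hA).trace_nonneg).1

theorem hasSum_trace_re (A : ℕ → Set (Sphere d)) (hA : ∀ n, MeasurableSet (A n))
    (hd : Pairwise (Function.onFun Disjoint A)) :
    HasSum (fun n => (μ.toVectorMeasure (A n)).trace.re)
      (μ.toVectorMeasure (⋃ n, A n)).trace.re := by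
  have h := μ.toVectorMeasure.m_iUnion hA hd
  have hc : Continuous (fun M : Matrix (Fin p) (Fin p) ℂ => M.trace.re) :=
    Complex.continuous_re.comp (continuous_id.matrix_trace)
  exact h.map (Complex.reAddGroupHom.comp (Matrix.traceAddMonoidHom (Fin p) ℂ)) hc

/-- The trace of `μ`, a finite positive measure. For a positive semidefinite `M` one has
`‖M‖_F ≤ tr M ≤ √p ‖M‖_F`, so it is equivalent, up to constants, to the total variation of `μ` in
the Frobenius norm. -/
def traceMeasure : Measure (Sphere d) :=
  Measure.ofMeasurable (fun A _ => ENNReal.ofReal (μ.toVectorMeasure A).trace.re)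
    (by simp)
    (by
      intro A hA hd
      have h := μ.hasSum_trace_re A hA hd
      rw [← h.tsum_eq]
      exact ENNReal.ofReal_tsum_of_nonneg (fun n => μ.trace_re_nonneg _ (hA n)) h.summable)

/-- The scalar measure `r^{d-1} dr tr μ(dθ)` on `(0, ∞) × S^{d-1}`. -/
def controlMass : Measure (Polar d) :=
  (Measure.volumeIoiPow (d - 1)).prod μ.traceMeasure

/-- The matrix valued control measure `r^{d-1} dr μ(dθ)`: the set `A` has the measure
`∫₀^∞ μ {θ | (r, θ) ∈ A} r^{d-1} dr`. -/
def control (A : Set (Polar d)) : Matrix (Fin p) (Fin p) ℂ :=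
  Matrix.of fun j k =>
    ∫ r, μ.toVectorMeasure (Prod.mk r ⁻¹' A) j k ∂(Measure.volumeIoiPow (d - 1))

/-- The Borel sets on which the control measure is finite; the random measure lives on these. -/
def FiniteMass (A : Set (Polar d)) : Prop :=
  MeasurableSet A ∧ μ.controlMass A < ∞

end DirectionalMeasure

/-! ### Random measures with orthogonal increments and the stochastic integral -/

section StochasticIntegral

variable {d p : ℕ} {Ω : Type*} [MeasurableSpace Ω]

/-- `B` is a zero-mean Hermitian `ℂ^p`-valued random measure on `(0, ∞) × S^{d-1}` with orthogonal
increments and control measure `r^{d-1} dr μ(dθ)`. Its values are square integrable random vectors;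
the series in `sigma_additive` converges in `L²`. -/
structure IsRandomMeasure (μ : DirectionalMeasure d p) (P : Measure Ω)
    (B : Set (Polar d) → Lp (EuclideanSpace ℂ (Fin p)) 2 P) : Prop where
  zero_mean : ∀ A, μ.FiniteMass A → ∫ ω, B A ω ∂P = 0
  empty : B ∅ = 0
  sigma_additive : ∀ A : ℕ → Set (Polar d), (∀ n, μ.FiniteMass (A n)) →
    Pairwise (Function.onFun Disjoint A) → μ.FiniteMass (⋃ n, A n) →
    HasSum (fun n => B (A n)) (B (⋃ n, A n))
  orthogonal : ∀ A A', μ.FiniteMass A → μ.FiniteMass A' → ∀ j k : Fin p,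
    ∫ ω, B A ω j * conj (B A' ω k) ∂P = μ.control (A ∩ A') j k
  hermitian : ∀ A, μ.FiniteMass A → ∀ᵐ ω ∂P, ∀ j : Fin p,
    B ((fun x : Polar d => (x.1, -x.2)) ⁻¹' A) ω j = conj (B A ω j)

/-- The integral `∑ₐ a B(f = a)` of a simple matrix valued function. -/
def simpleIntegral {P : Measure Ω} (B : Set (Polar d) → Lp (EuclideanSpace ℂ (Fin p)) 2 P)
    (f : SimpleFunc (Polar d) (Matrix (Fin p) (Fin p) ℂ)) :
    Lp (EuclideanSpace ℂ (Fin p)) 2 P :=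
  ∑ a ∈ f.range,
    (Matrix.toEuclideanCLM (n := Fin p) (𝕜 := ℂ) a).compLp (B (f ⁻¹' {a}))

/-- The squared `L²` norm of a matrix valued function with respect to the control measure. -/
def sqNorm (μ : DirectionalMeasure d p) (f : Polar d → Matrix (Fin p) (Fin p) ℂ) : ℝ≥0∞ :=
  ∫⁻ x, ∑ j, ∑ k, ‖f x j k‖ₑ ^ 2 ∂μ.controlMass

/-- `J` is the stochastic integral of the Borel function `f`, square integrable for the control
measure: it is the `L²` limit of the integrals of simple functions (vanishing off a set of finite
control measure) that converge to `f` in mean square. -/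
def IsStochasticIntegral (μ : DirectionalMeasure d p) {P : Measure Ω}
    (B : Set (Polar d) → Lp (EuclideanSpace ℂ (Fin p)) 2 P)
    (f : Polar d → Matrix (Fin p) (Fin p) ℂ) (J : Lp (EuclideanSpace ℂ (Fin p)) 2 P) : Prop :=
  (∀ j k, Measurable fun x => f x j k) ∧ sqNorm μ f < ∞ ∧
  ∃ g : ℕ → SimpleFunc (Polar d) (Matrix (Fin p) (Fin p) ℂ),
    (∀ n, μ.controlMass (Function.support (g n)) < ∞) ∧
    Tendsto (fun n => sqNorm μ (fun x => g n x - f x)) atTop (𝓝 0) ∧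
    Tendsto (fun n => simpleIntegral B (g n)) atTop (𝓝 J)

open Classical in
/-- The stochastic integral `∫ f dB` (`0` if it does not exist). -/
def stochasticIntegral (μ : DirectionalMeasure d p) {P : Measure Ω}
    (B : Set (Polar d) → Lp (EuclideanSpace ℂ (Fin p)) 2 P)
    (f : Polar d → Matrix (Fin p) (Fin p) ℂ) : Lp (EuclideanSpace ℂ (Fin p)) 2 P :=
  if h : ∃ J, IsStochasticIntegral μ B f J then h.choose else 0

end StochasticIntegral

/-! ### The multivariate Matérn process -/

/-- The integrand `exp(i⟨s, rθ⟩) c (a + φ(θ) i r I)^(-ν - (d/2) I)`, where `a`, `ν` and `c` are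
diagonal matrices. -/
def maternIntegrand {d p : ℕ} (a ν c : Fin p → ℝ) (φ : Sphere d → ℝ) (s : Space d)
    (x : Polar d) : Matrix (Fin p) (Fin p) ℂ :=
  Complex.exp (Complex.I * ((inner ℝ s ((x.1 : ℝ) • (x.2 : Space d)) : ℝ) : ℂ)) •
    (Matrix.diagonal (fun k => (c k : ℂ)) *
      matrixPow
        (Matrix.diagonal (fun k => (a k : ℂ)) +
          ((φ x.2 : ℂ) * Complex.I * ((x.1 : ℝ) : ℂ)) • (1 : Matrix (Fin p) (Fin p) ℂ))
        (-Matrix.diagonal (fun k => (ν k : ℂ)) -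
          ((d : ℂ) / 2) • (1 : Matrix (Fin p) (Fin p) ℂ)))

/-- Two processes indexed by `ℝ^d`, possibly on different probability spaces, have the same
finite-dimensional distributions. -/
def EqFDD {d p : ℕ} {Ω Ω' : Type*} [MeasurableSpace Ω] [MeasurableSpace Ω']
    (P : Measure Ω) (P' : Measure Ω') (Y : Space d → Ω → EuclideanSpace ℂ (Fin p))
    (Y' : Space d → Ω' → EuclideanSpace ℂ (Fin p)) : Prop :=
  ∀ I : Finset (Space d),
    IdentDistrib (fun ω (s : I) => Y s ω) (fun ω (s : I) => Y' s ω) P P'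

/-- The process `Y` has the finite-dimensional distributions of
`s ↦ ∫∫ exp(i⟨s, rθ⟩) c (a + φ(θ) i r I)^(-ν - (d/2) I) B(dr, dθ)`. -/
def IsMaternProcess {d p : ℕ} {Ω Ω' : Type*} [MeasurableSpace Ω] [MeasurableSpace Ω']
    (μ : DirectionalMeasure d p) (a ν c : Fin p → ℝ) (φ : Sphere d → ℝ) (P : Measure Ω)
    (B : Set (Polar d) → Lp (EuclideanSpace ℂ (Fin p)) 2 P)
    (P' : Measure Ω') (Y : Space d → Ω' → EuclideanSpace ℂ (Fin p)) : Prop :=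
  EqFDD P' P Y (fun s ω => stochasticIntegral μ B (maternIntegrand a ν c φ s) ω)

/-! ### The Matérn covariance -/

/-- The modified Bessel function of the second kind of real order `ν`, for `z > 0`:
`K_ν(z) = ∫₀^∞ exp(-z cosh t) cosh(ν t) dt`. -/
def besselK (ν z : ℝ) : ℝ :=
  ∫ t in Set.Ioi (0 : ℝ), Real.exp (-z * Real.cosh t) * Real.cosh (ν * t)

/-- The Matérn covariance at distance `h ≥ 0` with inverse range `a`, smoothness `ν` and variance
`v`: `v 2^(1-ν) / Γ(ν) (a h)^ν K_ν(a h)`, with the limit `v` as value at `h = 0`. -/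
def maternCov (h a ν v : ℝ) : ℝ :=
  if h = 0 then v
  else v * 2 ^ (1 - ν) / Real.Gamma ν * (a * h) ^ ν * besselK ν (a * h)

/-- The scalar process `Z` is square integrable and zero-mean, and has the (stationary, isotropic)
Matérn covariance `E[Z(s) conj Z(t)] = M(‖s - t‖; a, ν, v)`. -/
def HasMaternCovariance {d : ℕ} {Ω : Type*} [MeasurableSpace Ω] (P : Measure Ω)
    (Z : Space d → Ω → ℂ) (a ν v : ℝ) : Prop :=
  (∀ s, MemLp (Z s) 2 P) ∧ (∀ s, ∫ ω, Z s ω ∂P = 0) ∧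
  ∀ s t, ∫ ω, Z s ω * conj (Z t ω) ∂P = (maternCov ‖s - t‖ a ν v : ℂ)

end MaternField

end

noncomputable section

namespace MaternField

/-! ### Fourier transform of the Matérn spectral density -/

/-! Because `a`, `ν` and `c` are diagonal, the matrix power is a diagonal matrix of principal
complex powers (`matrixPow_diagonal`). The `j`-th coordinate of the process is therefore a scalar
stochastic integral against the `j`-th coordinate of `B`, and its covariance involves `μ` only
through `μ_jj = σ_jj dθ`. The L² isometry (`IsStochasticIntegral.integral_mul_conj`) turns `E[Y_j(s)
conj Y_j(t)]` into `σ_jj` times an integral over polar coordinates. The exponent is real and `φ =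
±1`, so the phases of the two powers cancel, and with `x = rθ` the integrand becomes `c_j²
e^{i⟨s-t,x⟩} (a_j² + ‖x‖²)^(-ν_j - d/2)` (`maternEntry_mul_conj`). The covariance is thus the
Fourier transform of the Matérn spectral density.

That transform is computed by subordination: the power is a Gamma mixture of Gaussians in `x`,
Fubini and the Gaussian Fourier transform leave a one-dimensional integral, and an exponential
substitution recognises it as `besselK`. The constant `c_j` normalises the density to mass one.

Since `stochasticIntegral` has a default value, existence of the L² limit must also be proved
(`exists_isStochasticIntegral`). Means and covariances finally pass to `Y` because they depend only
on one- and two-point laws. -/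

theorem integrableOn_rpow_mul_exp_neg_sub_div {ν a : ℝ} (hν : 0 < ν) (ha : 0 < a) (h : ℝ) :
    IntegrableOn (fun u : ℝ => u ^ (ν - 1) * Real.exp (-(a ^ 2 * u) - h ^ 2 / (4 * u)))
      (Set.Ioi 0) := by
  have h1 := integrableOn_rpow_mul_exp_neg_mul_rpow (p := 1) (s := ν - 1) (b := a ^ 2)
    (by linarith) one_pos (by positivity)
  refine Integrable.mono' h1 ?_ ?_
  · exact Measurable.aestronglyMeasurable (by fun_prop)
  · refine (ae_restrict_mem measurableSet_Ioi).mono fun u hu => ?_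
    have hu : 0 < u := hu
    rw [Real.norm_of_nonneg (by positivity), Real.rpow_one]
    gcongr
    have : 0 ≤ h ^ 2 / (4 * u) := by positivity
    linarith

/-- Substitute `u = k e^t`. The choice `k = h / (2a)` balances the two terms of the exponent, so
that `a² u + h² / (4u) = a h cosh t`. Folding the line at `0` turns `e^{νt}` into `2 cosh (νt)`. -/
theorem integral_rpow_mul_exp_neg_sub_div {ν a h : ℝ} (hν : 0 < ν) (ha : 0 < a) (hh : 0 < h) :
    ∫ u in Set.Ioi (0 : ℝ), u ^ (ν - 1) * Real.exp (-(a ^ 2 * u) - h ^ 2 / (4 * u)) =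
      2 * (h / (2 * a)) ^ ν * besselK ν (a * h) := by
  set k := h / (2 * a) with hk
  have hk0 : 0 < k := by positivity
  set F : ℝ → ℝ := fun t => k ^ ν * (Real.exp (ν * t) * Real.exp (-(a * h) * Real.cosh t)) with hF
  set g : ℝ → ℝ := fun u => u ^ (ν - 1) * Real.exp (-(a ^ 2 * u) - h ^ 2 / (4 * u)) with hg
  have himg : (fun t : ℝ => k * Real.exp t) '' Set.univ = Set.Ioi 0 := by
    ext u
    simp only [Set.image_univ, Set.mem_range, Set.mem_Ioi]
    constructor
    · rintro ⟨t, rfl⟩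
      positivity
    · intro hu
      exact ⟨Real.log (u / k), by rw [Real.exp_log (by positivity)]; field_simp⟩
  have hder : ∀ t ∈ (Set.univ : Set ℝ),
      HasDerivWithinAt (fun t : ℝ => k * Real.exp t) (k * Real.exp t) Set.univ t :=
    fun t _ => ((Real.hasDerivAt_exp t).const_mul k).hasDerivWithinAt
  have hinj : Set.InjOn (fun t : ℝ => k * Real.exp t) Set.univ := fun s _ t _ hst =>
    Real.exp_injective (mul_left_cancel₀ hk0.ne' hst)
  have hcomp : ∀ t : ℝ, |k * Real.exp t| • g (k * Real.exp t) = F t := by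
    intro t
    rw [abs_of_pos (by positivity), smul_eq_mul, hg, hF]
    have e1 : -(a ^ 2 * (k * Real.exp t)) - h ^ 2 / (4 * (k * Real.exp t)) =
        -(a * h) * Real.cosh t := by
      rw [Real.cosh_eq, Real.exp_neg, hk]
      field_simp
      ring
    have e2 : k * Real.exp t * (k * Real.exp t) ^ (ν - 1) = k ^ ν * Real.exp (ν * t) := by
      rw [← Real.rpow_one_add' (by positivity) (by linarith), add_sub_cancel,
        Real.mul_rpow hk0.le (Real.exp_pos t).le, ← Real.exp_mul, mul_comm t]
    simp only [e1]
    rw [← mul_assoc, e2]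
    ring
  have hFint : Integrable F := by
    have := (integrableOn_image_iff_integrableOn_abs_deriv_smul MeasurableSet.univ hder hinj g).1
      (by rw [himg]; exact integrableOn_rpow_mul_exp_neg_sub_div hν ha h)
    simp only [hcomp] at this
    simpa using this
  have hsub := integral_image_eq_integral_abs_deriv_smul MeasurableSet.univ hder hinj g
  rw [himg] at hsub
  simp only [hcomp, Measure.restrict_univ] at hsub
  rw [hsub, ← intervalIntegral.integral_Iic_add_Ioi (b := 0) hFint.integrableOn hFint.integrableOn,
    ← neg_zero, ← integral_comp_neg_Ioi, neg_zero, ← integral_add hFint.comp_neg.integrableOn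
      hFint.integrableOn, besselK, ← integral_const_mul]
  refine integral_congr_ae (Eventually.of_forall fun t => ?_)
  simp only [hF, Real.cosh_neg]
  rw [Real.cosh_eq (ν * t)]
  ring_nf

/-- This justifies Fubini for the Gaussian mixture. The `x`-integral of the modulus is
`(π/u)^(d/2)`, which removes `d/2` from the power of `u`; what remains is integrable at `0` because
`ν > 0`. -/
theorem integrable_gaussian_subordination {d : ℕ} {ν a : ℝ} (hν : 0 < ν) (ha : 0 < a)
    (h : Space d) :
    Integrable (fun q : Space d × ℝ => Complex.exp (Complex.I * ((inner ℝ h q.1 : ℝ) : ℂ)) *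
      ((q.2 ^ (ν + d / 2 - 1) * Real.exp (-((a ^ 2 + ‖q.1‖ ^ 2) * q.2)) : ℝ) : ℂ))
      ((volume : Measure (Space d)).prod (volume.restrict (Set.Ioi (0 : ℝ)))) := by
  have hnorm : ∀ x : Space d, ∀ u : ℝ, 0 < u →
      ‖Complex.exp (Complex.I * ((inner ℝ h x : ℝ) : ℂ)) *
        ((u ^ (ν + d / 2 - 1) * Real.exp (-((a ^ 2 + ‖x‖ ^ 2) * u)) : ℝ) : ℂ)‖ =
      u ^ (ν + d / 2 - 1) * Real.exp (-(a ^ 2 * u)) * Real.exp (-u * ‖x‖ ^ 2) := by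
    intro x u hu
    rw [norm_mul, mul_comm Complex.I, Complex.norm_exp_ofReal_mul_I, one_mul, Complex.norm_real,
      Real.norm_of_nonneg (by positivity), mul_assoc, ← Real.exp_add]
    congr 2
    ring
  have hgauss : ∀ u : ℝ, 0 < u → Integrable fun x : Space d => Real.exp (-u * ‖x‖ ^ 2) := by
    intro u hu
    have := (GaussianFourier.integrable_cexp_neg_mul_sq_norm_add (V := Space d) (b := (u : ℂ))
      (by simpa using hu) 0 0).norm
    refine this.congr (Eventually.of_forall fun x => ?_)
    simp only [Complex.norm_exp]
    congr 1
    simp [← Complex.ofReal_pow]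
  have hmeas : Measurable fun q : Space d × ℝ =>
      Complex.exp (Complex.I * ((inner ℝ h q.1 : ℝ) : ℂ)) *
      ((q.2 ^ (ν + d / 2 - 1) * Real.exp (-((a ^ 2 + ‖q.1‖ ^ 2) * q.2)) : ℝ) : ℂ) := by
    fun_prop
  refine (integrable_prod_iff' hmeas.aestronglyMeasurable).2 ⟨?_, ?_⟩
  · refine (ae_restrict_mem measurableSet_Ioi).mono fun u hu => ?_
    refine (integrable_norm_iff (hmeas.comp (measurable_id.prodMk
      measurable_const)).aestronglyMeasurable).1 ?_
    simp only [Function.comp_def, id, hnorm _ u hu]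
    exact (hgauss u hu).const_mul _
  -- Taking `h = 0` kills the `1/u` term and leaves the plain Gamma integrand.
  · have hI := (integrableOn_rpow_mul_exp_neg_sub_div hν ha 0).const_mul (Real.pi ^ ((d : ℝ) / 2))
    refine hI.congr ((ae_restrict_mem measurableSet_Ioi).mono fun u hu => ?_)
    have hu : 0 < u := hu
    simp only [hnorm _ u hu]
    rw [integral_const_mul, GaussianFourier.integral_rexp_neg_mul_sq_norm hu,
      finrank_euclideanSpace_fin, Real.div_rpow Real.pi_pos.le hu.le,
      show ν + (d : ℝ) / 2 - 1 = (ν - 1) + d / 2 by ring, Real.rpow_add hu]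
    have := (Real.rpow_pos_of_pos hu ((d : ℝ) / 2)).ne'
    field_simp
    congr 1
    field_simp
    ring

theorem gamma_subordination {α q : ℝ} (hα : 0 < α) (hq : 0 < q) :
    q ^ (-α) = (Real.Gamma α)⁻¹ *
      ∫ u in Set.Ioi (0 : ℝ), u ^ (α - 1) * Real.exp (-(q * u)) := by
  rw [Real.integral_rpow_mul_exp_neg_mul_Ioi hα hq, one_div, Real.inv_rpow hq.le,
    Real.rpow_neg hq.le]
  field_simp [(Real.Gamma_pos_of_pos hα).ne']

theorem maternSpectral_eq_integral {d : ℕ} {ν a : ℝ} (hν : 0 < ν) (ha : 0 < a) (h x : Space d) :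
    Complex.exp (Complex.I * ((inner ℝ h x : ℝ) : ℂ)) *
      (((a ^ 2 + ‖x‖ ^ 2) ^ (-(ν + d / 2)) : ℝ) : ℂ) =
    ((Real.Gamma (ν + d / 2))⁻¹ : ℝ) * ∫ u in Set.Ioi (0 : ℝ),
      Complex.exp (Complex.I * ((inner ℝ h x : ℝ) : ℂ)) *
      ((u ^ (ν + d / 2 - 1) * Real.exp (-((a ^ 2 + ‖x‖ ^ 2) * u)) : ℝ) : ℂ) := by
  rw [integral_const_mul, integral_complex_ofReal,
    gamma_subordination (by positivity : 0 < ν + d / 2) (by positivity : 0 < a ^ 2 + ‖x‖ ^ 2)]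
  push_cast
  ring

theorem integrable_maternSpectral {d : ℕ} {ν a : ℝ} (hν : 0 < ν) (ha : 0 < a) (h : Space d) :
    Integrable fun x : Space d => Complex.exp (Complex.I * ((inner ℝ h x : ℝ) : ℂ)) *
      (((a ^ 2 + ‖x‖ ^ 2) ^ (-(ν + d / 2)) : ℝ) : ℂ) := by
  simp_rw [maternSpectral_eq_integral hν ha h]
  exact (integrable_gaussian_subordination hν ha h).integral_prod_left.const_mul _

theorem integral_maternSpectral {d : ℕ} {ν a : ℝ} (hν : 0 < ν) (ha : 0 < a) (h : Space d) :
    ∫ x : Space d, Complex.exp (Complex.I * ((inner ℝ h x : ℝ) : ℂ)) *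
      (((a ^ 2 + ‖x‖ ^ 2) ^ (-(ν + d / 2)) : ℝ) : ℂ) =
    ((Real.pi ^ ((d : ℝ) / 2) / Real.Gamma (ν + d / 2) * ∫ u in Set.Ioi (0 : ℝ),
      u ^ (ν - 1) * Real.exp (-(a ^ 2 * u) - ‖h‖ ^ 2 / (4 * u)) : ℝ) : ℂ) := by
  simp_rw [maternSpectral_eq_integral hν ha h]
  rw [integral_const_mul, integral_integral_swap (integrable_gaussian_subordination hν ha h)]
  rw [div_eq_inv_mul (Real.pi ^ _), mul_assoc, Complex.ofReal_mul (Real.Gamma _)⁻¹]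
  congr 1
  rw [← integral_const_mul, ← integral_complex_ofReal]
  refine setIntegral_congr_fun measurableSet_Ioi fun u hu => ?_
  have hu : 0 < u := hu
  have e1 : ∀ x : Space d, Complex.exp (Complex.I * ((inner ℝ h x : ℝ) : ℂ)) *
      ((u ^ (ν + d / 2 - 1) * Real.exp (-((a ^ 2 + ‖x‖ ^ 2) * u)) : ℝ) : ℂ) =
      ((u ^ (ν + d / 2 - 1) * Real.exp (-(a ^ 2 * u)) : ℝ) : ℂ) *
        Complex.exp (-(u : ℂ) * (‖x‖ : ℂ) ^ 2 + Complex.I * ((inner ℝ h x : ℝ) : ℂ)) := by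
    intro x
    push_cast
    rw [mul_assoc, ← Complex.exp_add, mul_left_comm, ← Complex.exp_add]
    congr 2
    ring
  simp only [e1]
  rw [integral_const_mul, GaussianFourier.integral_cexp_neg_mul_sq_norm_add (by simpa using hu),
    finrank_euclideanSpace_fin]
  have e2 : ((Real.pi : ℂ) / u) ^ ((d : ℂ) / 2) = (((Real.pi / u) ^ ((d : ℝ) / 2) : ℝ) : ℂ) := by
    rw [Complex.ofReal_cpow (by positivity)]
    push_cast
    rfl
  have e3 : Complex.exp (Complex.I ^ 2 * (‖h‖ : ℂ) ^ 2 / (4 * u)) =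
      ((Real.exp (-(‖h‖ ^ 2 / (4 * u))) : ℝ) : ℂ) := by
    rw [Complex.I_sq]
    push_cast
    congr 1
    ring
  rw [e2, e3]
  norm_cast
  rw [Real.div_rpow Real.pi_pos.le hu.le, sub_eq_add_neg (-(a ^ 2 * u)), Real.exp_add,
    show ν + (d : ℝ) / 2 - 1 = (ν - 1) + d / 2 by ring, Real.rpow_add hu]
  have := (Real.rpow_pos_of_pos hu ((d : ℝ) / 2)).ne'
  field_simp

/-- At `h = 0` the subordination integral is `Γ(ν) a^(-2ν)`, so `c²` is exactly the reciprocal of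
the total mass of the density. For `h ≠ 0` the Bessel form applies and the same constant gives the
Matérn prefactor. -/
theorem integral_maternSpectral_eq_maternCov {d : ℕ} {ν a c : ℝ} (hν : 0 < ν) (ha : 0 < a)
    (hc : c = a ^ ν * Real.sqrt (Real.Gamma (ν + d / 2)) /
      (Real.pi ^ ((d : ℝ) / 4) * Real.sqrt (Real.Gamma ν))) (v : ℝ) (h : Space d) :
    (v : ℂ) * ∫ x : Space d, ((c ^ 2 : ℝ) : ℂ) *
      (Complex.exp (Complex.I * ((inner ℝ h x : ℝ) : ℂ)) *
      (((a ^ 2 + ‖x‖ ^ 2) ^ (-(ν + d / 2)) : ℝ) : ℂ)) = (maternCov ‖h‖ a ν v : ℂ) := by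
  have hG : 0 < Real.Gamma ν := Real.Gamma_pos_of_pos hν
  have hGd : 0 < Real.Gamma (ν + d / 2) := Real.Gamma_pos_of_pos (by positivity)
  have hpi : 0 < Real.pi ^ ((d : ℝ) / 2) := Real.rpow_pos_of_pos Real.pi_pos _
  have hc2 : c ^ 2 = (a ^ ν) ^ 2 * Real.Gamma (ν + d / 2) /
      (Real.pi ^ ((d : ℝ) / 2) * Real.Gamma ν) := by
    rw [hc, div_pow, mul_pow, mul_pow, Real.sq_sqrt hG.le, Real.sq_sqrt hGd.le,
      ← Real.rpow_natCast (Real.pi ^ _), ← Real.rpow_mul Real.pi_pos.le]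
    congr 3
    push_cast
    ring
  rw [integral_const_mul, integral_maternSpectral hν ha]
  norm_cast
  rw [hc2, maternCov]
  have haν : 0 < a ^ ν := Real.rpow_pos_of_pos ha _
  split_ifs with h0
  · simp only [h0]
    have := Real.integral_rpow_mul_exp_neg_mul_Ioi hν (by positivity : 0 < a ^ 2)
    simp only [ne_eq, OfNat.ofNat_ne_zero, not_false_eq_true, zero_pow, zero_div, sub_zero]
    rw [this, one_div, Real.inv_rpow (by positivity), ← Real.rpow_natCast a 2, ← Real.rpow_mul ha.le,
      mul_comm ((2 : ℕ) : ℝ) ν, Real.rpow_mul ha.le, Real.rpow_natCast]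
    field_simp
  · have hh : 0 < ‖h‖ := lt_of_le_of_ne (norm_nonneg _) (Ne.symm h0)
    rw [integral_rpow_mul_exp_neg_sub_div hν ha hh, Real.div_rpow hh.le (by positivity),
      Real.mul_rpow zero_le_two ha.le, Real.mul_rpow ha.le hh.le, Real.rpow_sub two_pos,
      Real.rpow_one]
    have h2 : 0 < (2 : ℝ) ^ ν := by positivity
    field_simp

/-! ### Matrix powers of diagonal matrices -/

/-- The Cayley transform `w = (1 - z)/(1 + z)` sends the right half-plane into the unit disc. The
series is `-2 artanh w`, read off from the arctangent series at `-i w`, and `(1 - w)/(1 + w) = z`.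
-/
theorem hasSum_gregory {z : ℂ} (hz : 0 < z.re) :
    HasSum (fun n : ℕ => (-2 / (2 * (n : ℂ) + 1)) * ((1 - z) * (1 + z)⁻¹) ^ (2 * n + 1))
      (Complex.log z) := by
  have h1 : (1 + z) ≠ 0 := fun h => by
    have := congrArg Complex.re h
    simp at this
    linarith
  have h0 : z ≠ 0 := fun h => by simp [h] at hz
  set w := (1 - z) * (1 + z)⁻¹ with hw
  -- Equivalent to `‖1 - z‖ < ‖1 + z‖`, that is, to `Re z > 0`.
  have hlt : ‖-Complex.I * w‖ < 1 := by
    rw [norm_mul, norm_neg, Complex.norm_I, one_mul, hw, norm_mul, norm_inv, ← div_eq_mul_inv,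
      div_lt_one (norm_pos_iff.2 h1)]
    refine lt_of_pow_lt_pow_left₀ 2 (norm_nonneg _) ?_
    rw [← Complex.normSq_eq_norm_sq, ← Complex.normSq_eq_norm_sq, Complex.normSq_apply,
      Complex.normSq_apply]
    simp
    nlinarith
  have h := (Complex.hasSum_arctan hlt).mul_left (-2 * Complex.I)
  have e1 : (1 + -Complex.I * w * Complex.I) = 1 + w := by
    linear_combination (-w) * Complex.I_sq
  have e2 : (1 - -Complex.I * w * Complex.I) = 1 - w := by
    linear_combination w * Complex.I_sq
  have e3 : (1 + w) / (1 - w) = z⁻¹ := by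
    have : 1 - w = 2 * z / (1 + z) := by rw [hw]; field_simp; ring
    have h' : 1 + w = 2 / (1 + z) := by rw [hw]; field_simp; ring
    rw [this, h']
    field_simp
  have harg : z.arg ≠ Real.pi := by
    intro h
    have := (Complex.arg_eq_pi_iff.1 h).1
    linarith
  have e4 : -2 * Complex.I * Complex.arctan (-Complex.I * w) = Complex.log z := by
    rw [Complex.arctan, e1, e2, e3, Complex.log_inv _ harg]
    linear_combination (-Complex.log z) * Complex.I_sq
  rw [e4] at h
  refine h.congr_fun fun n => ?_
  have e5 : (-Complex.I) ^ (2 * n + 1) = (-1) ^ n * -Complex.I := by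
    rw [pow_succ, pow_mul, neg_sq, Complex.I_sq]
  have e6 : ((-1 : ℂ) ^ n) * (-1) ^ n = 1 := by rw [← mul_pow]; simp
  have h2 : (2 * (n : ℂ) + 1) ≠ 0 := by exact_mod_cast (by omega : 2 * n + 1 ≠ 0)
  rw [mul_pow (-Complex.I), e5]
  push_cast
  clear_value w
  rw [div_mul_eq_mul_div, mul_div_assoc', div_left_inj' h2]
  linear_combination 2 * w ^ (2 * n + 1) * e6 -
    2 * w ^ (2 * n + 1) * (-1) ^ n * (-1) ^ n * Complex.I_sq

theorem matrixLog_diagonal {p : ℕ} (z : Fin p → ℂ) (hz : ∀ k, 0 < (z k).re) :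
    matrixLog (Matrix.diagonal z) = Matrix.diagonal fun k => Complex.log (z k) := by
  have hinv : (1 + Matrix.diagonal z)⁻¹ = Matrix.diagonal fun k => (1 + z k)⁻¹ := by
    rw [← Matrix.diagonal_one, Matrix.diagonal_add]
    refine Matrix.inv_eq_right_inv ?_
    rw [Matrix.diagonal_mul_diagonal, ← Matrix.diagonal_one]
    congr 1
    funext k
    refine mul_inv_cancel₀ fun h => ?_
    have := congrArg Complex.re h
    simp at this
    linarith [hz k]
  have hs : HasSum (fun n : ℕ => fun k => (-2 / (2 * (n : ℂ) + 1)) *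
      ((1 - z k) * (1 + z k)⁻¹) ^ (2 * n + 1)) fun k => Complex.log (z k) :=
    Pi.hasSum.2 fun k => hasSum_gregory (hz k)
  rw [matrixLog, ← hs.matrix_diagonal.tsum_eq]
  congr 1
  funext n
  rw [hinv, ← Matrix.diagonal_one, Matrix.diagonal_sub, Matrix.diagonal_mul_diagonal,
    Matrix.diagonal_pow, ← Matrix.diagonal_smul]
  rfl

theorem matrixPow_diagonal {p : ℕ} (z h : Fin p → ℂ) (hz : ∀ k, 0 < (z k).re) :
    matrixPow (Matrix.diagonal z) (Matrix.diagonal h) = Matrix.diagonal fun k => z k ^ h k := by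
  rw [matrixPow, matrixLog_diagonal z hz, Matrix.diagonal_mul_diagonal, Matrix.exp_diagonal]
  congr 1
  funext k
  have h0 : z k ≠ 0 := fun h => by simpa [h] using hz k
  rw [Pi.coe_exp, Complex.cpow_def_of_ne_zero h0, Complex.exp_eq_exp_ℂ]

/-- The diagonal entries of the Matérn integrand. -/
def maternEntry {d : ℕ} (a ν c : ℝ) (φ : Sphere d → ℝ) (s : Space d) (x : Polar d) : ℂ :=
  Complex.exp (Complex.I * ((inner ℝ s ((x.1 : ℝ) • (x.2 : Space d)) : ℝ) : ℂ)) *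
    (c * ((a : ℂ) + (φ x.2 : ℂ) * Complex.I * ((x.1 : ℝ) : ℂ)) ^ ((-ν - d / 2 : ℝ) : ℂ))

theorem maternIntegrand_eq_diagonal {d p : ℕ} (a ν c : Fin p → ℝ) (ha : ∀ j, 0 < a j)
    (φ : Sphere d → ℝ) (s : Space d) (x : Polar d) :
    maternIntegrand a ν c φ s x =
      Matrix.diagonal fun j => maternEntry (a j) (ν j) (c j) φ s x := by
  have hneg : -Matrix.diagonal (fun k => (ν k : ℂ)) = Matrix.diagonal fun k => -(ν k : ℂ) :=
    Matrix.diagonal_neg _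
  rw [maternIntegrand, hneg, ← Matrix.diagonal_one, ← Matrix.diagonal_smul,
    ← Matrix.diagonal_smul, Matrix.diagonal_add, Matrix.diagonal_sub, matrixPow_diagonal,
    Matrix.diagonal_mul_diagonal, ← Matrix.diagonal_smul]
  · congr 1
    funext j
    simp [maternEntry]
  · intro k
    simp [ha k]

theorem measurable_maternEntry {d : ℕ} (a ν c : ℝ) (φ : Sphere d → ℝ) (hφ : Measurable φ)
    (s : Space d) : Measurable (maternEntry a ν c φ s) := by
  unfold maternEntry
  have h1 : Measurable fun x : Polar d => φ x.2 := hφ.comp measurable_snd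
  fun_prop

/-- A real power of `z` times its conjugate depends only on `‖z‖`, and `‖a ± i r‖² = a² + r²`. The
sign `φ` shifts phases only, so it drops out. -/
theorem maternEntry_mul_conj {d : ℕ} {a : ℝ} (ν c : ℝ) (ha : 0 < a) (φ : Sphere d → ℝ)
    (hφ : ∀ θ, φ θ = 1 ∨ φ θ = -1) (s t : Space d) (x : Polar d) :
    maternEntry a ν c φ s x * conj (maternEntry a ν c φ t x) =
      ((c ^ 2 : ℝ) : ℂ) * (Complex.exp (Complex.I *
        ((inner ℝ (s - t) ((x.1 : ℝ) • (x.2 : Space d)) : ℝ) : ℂ)) *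
      (((a ^ 2 + ‖(x.1 : ℝ) • (x.2 : Space d)‖ ^ 2) ^ (-(ν + d / 2)) : ℝ) : ℂ)) := by
  set y := (x.1 : ℝ) • (x.2 : Space d) with hy
  have hyn : ‖y‖ ^ 2 = (x.1 : ℝ) ^ 2 := by
    rw [hy, norm_smul, mem_sphere_zero_iff_norm.1 x.2.2]
    simp
  set z : ℂ := (a : ℂ) + (φ x.2 : ℂ) * Complex.I * ((x.1 : ℝ) : ℂ) with hz
  have hzre : z.re = a := by simp [hz]
  have hz0 : z ≠ 0 := fun h => by rw [h] at hzre; simp at hzre; linarith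
  have hzn : ‖z‖ ^ 2 = a ^ 2 + ‖y‖ ^ 2 := by
    rw [← Complex.normSq_eq_norm_sq, Complex.normSq_apply, hyn]
    rcases hφ x.2 with h | h <;> simp [hz, h] <;> ring
  have h1 : z ^ ((-ν - d / 2 : ℝ) : ℂ) * conj (z ^ ((-ν - d / 2 : ℝ) : ℂ)) =
      (((a ^ 2 + ‖y‖ ^ 2) ^ (-(ν + d / 2)) : ℝ) : ℂ) := by
    rw [Complex.mul_conj, Complex.normSq_eq_norm_sq, Complex.norm_cpow_real, ← hzn,
      ← Real.rpow_natCast, ← Real.rpow_natCast, ← Real.rpow_mul (norm_nonneg _),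
      ← Real.rpow_mul (norm_nonneg _)]
    congr 2
    push_cast
    ring
  have h2 : Complex.exp (Complex.I * ((inner ℝ s y : ℝ) : ℂ)) *
      conj (Complex.exp (Complex.I * ((inner ℝ t y : ℝ) : ℂ))) =
      Complex.exp (Complex.I * ((inner ℝ (s - t) y : ℝ) : ℂ)) := by
    rw [← Complex.exp_conj, ← Complex.exp_add, inner_sub_left]
    congr 1
    simp
    ring
  simp only [maternEntry, ← hz, ← hy, map_mul, Complex.conj_ofReal]
  rw [← h2, ← h1]
  push_cast
  ring

/-! ### The control measure with uniform diagonal -/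

instance (d : ℕ) : IsFiniteMeasure (surfaceMeasure d) := by
  unfold surfaceMeasure
  infer_instance

/-- The measure `r^{d-1} dr dθ` on `(0, ∞) × S^{d-1}`. -/
def polarMeasure (d : ℕ) : Measure (Polar d) :=
  (Measure.volumeIoiPow (d - 1)).prod (surfaceMeasure d)

instance (d : ℕ) : SigmaFinite (polarMeasure d) := by
  unfold polarMeasure
  infer_instance

/-- Lebesgue measure is `r^{d-1} dr dθ` in polar coordinates. -/
theorem integral_polarMeasure {d : ℕ} (hd : 1 ≤ d) (F : Space d → ℂ) :
    ∫ x, F ((x.1 : ℝ) • (x.2 : Space d)) ∂polarMeasure d = ∫ y, F y := by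
  have : Nonempty (Fin d) := ⟨⟨0, hd⟩⟩
  have hmp := (volume : Measure (Space d)).measurePreserving_homeomorphUnitSphereProd
  rw [finrank_euclideanSpace_fin] at hmp
  have h1 := hmp.integral_comp (Homeomorph.measurableEmbedding _)
    fun q : Sphere d × Set.Ioi (0 : ℝ) => F ((q.2 : ℝ) • (q.1 : Space d))
  have h2 : ∀ y : ({0}ᶜ : Set (Space d)), F (((homeomorphUnitSphereProd (Space d) y).2 : ℝ) •
      ((homeomorphUnitSphereProd (Space d) y).1 : Space d)) = F y := by
    intro y
    congr 1
    have : ‖(y : Space d)‖ ≠ 0 := norm_ne_zero_iff.2 y.2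
    simp [smul_smul, this]
  simp only [h2] at h1
  rw [integral_subtype_comap (measurableSet_singleton _).compl F] at h1
  -- Polar coordinates omit the origin, a null set since `d ≥ 1`.
  rw [restrict_compl_singleton] at h1
  rw [h1, polarMeasure]
  exact integral_prod_swap (μ := (surfaceMeasure d)) (ν := Measure.volumeIoiPow (d - 1))
    fun q : Sphere d × Set.Ioi (0 : ℝ) => F ((q.2 : ℝ) • (q.1 : Space d))

theorem integrable_polarMeasure {d : ℕ} {F : Space d → ℂ} (hF : Integrable F) :
    Integrable (fun x : Polar d => F ((x.1 : ℝ) • (x.2 : Space d))) (polarMeasure d) := by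
  have hmp := (volume : Measure (Space d)).measurePreserving_homeomorphUnitSphereProd
  rw [finrank_euclideanSpace_fin] at hmp
  have h1 := hmp.integrable_comp_emb (Homeomorph.measurableEmbedding _)
    (g := fun q : Sphere d × Set.Ioi (0 : ℝ) => F ((q.2 : ℝ) • (q.1 : Space d)))
  have h2 : ((fun q : Sphere d × Set.Ioi (0 : ℝ) => F ((q.2 : ℝ) • (q.1 : Space d))) ∘
      homeomorphUnitSphereProd (Space d)) = F ∘ Subtype.val := by
    funext y
    simp only [Function.comp_apply]
    congr 1
    have : ‖(y : Space d)‖ ≠ 0 := norm_ne_zero_iff.2 y.2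
    simp [smul_smul, this]
  rw [h2, ← (MeasurableEmbedding.subtype_coe
    (measurableSet_singleton (0 : Space d)).compl).integrableOn_range_iff_comap] at h1
  exact (h1.1 hF.integrableOn).swap

section Control

variable {d p : ℕ} {μ : DirectionalMeasure d p} {σ : Fin p → ℝ}

/-- The trace sees only the diagonal of `μ`. Hence square integrability for the control measure
reduces to square integrability for `r^{d-1} dr dθ`, whatever the off-diagonal entries are. -/
theorem traceMeasure_eq_smul (hσ : ∀ j, 0 < σ j)
    (hμ : ∀ j, ∀ A : Set (Sphere d), MeasurableSet A →
      μ.toVectorMeasure A j j = ((σ j * (surfaceMeasure d).real A : ℝ) : ℂ)) :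
    μ.traceMeasure = ENNReal.ofReal (∑ j, σ j) • surfaceMeasure d := by
  ext A hA
  rw [DirectionalMeasure.traceMeasure, Measure.ofMeasurable_apply _ hA, Matrix.trace]
  simp only [Matrix.diag_apply, hμ _ A hA, Complex.re_sum, Complex.ofReal_re]
  rw [← Finset.sum_mul, ENNReal.ofReal_mul (Finset.sum_nonneg fun j _ => (hσ j).le),
    ofReal_measureReal]
  rfl

theorem controlMass_eq_smul (hσ : ∀ j, 0 < σ j)
    (hμ : ∀ j, ∀ A : Set (Sphere d), MeasurableSet A →
      μ.toVectorMeasure A j j = ((σ j * (surfaceMeasure d).real A : ℝ) : ℂ)) :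
    μ.controlMass = ENNReal.ofReal (∑ j, σ j) • polarMeasure d := by
  rw [DirectionalMeasure.controlMass, traceMeasure_eq_smul hσ hμ, polarMeasure,
    Measure.prod_smul_right]

theorem control_diag (hμ : ∀ j, ∀ A : Set (Sphere d), MeasurableSet A →
      μ.toVectorMeasure A j j = ((σ j * (surfaceMeasure d).real A : ℝ) : ℂ))
    {A : Set (Polar d)} (hA : MeasurableSet A) (j : Fin p) :
    μ.control A j j = ((σ j * (polarMeasure d).real A : ℝ) : ℂ) := by
  simp only [DirectionalMeasure.control, Matrix.of_apply,
    hμ j _ (measurable_prodMk_left hA)]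
  rw [integral_complex_ofReal, integral_const_mul]
  congr 2
  simp only [Measure.real, polarMeasure]
  rw [integral_toReal (measurable_measure_prodMk_left hA).aemeasurable
    (Eventually.of_forall fun _ => measure_lt_top _ _), Measure.prod_apply hA]

end Control

/-! ### Orthogonal set functions and integrals of simple functions -/

section OrthogonalSetFunction

variable {X α β H : Type*} [MeasurableSpace X] [NormedAddCommGroup H] [InnerProductSpace ℂ H]

/-- The integral `∑ₐ e(a) b(g = a)` of the scalar simple function `e ∘ g`. -/
def scalarIntegral (b : Set X → H) (g : SimpleFunc X α) (e : α → ℂ) : H :=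
  ∑ x ∈ g.range, e x • b (g ⁻¹' {x})

theorem integral_simpleFunc_pair {m : Measure X} (g : SimpleFunc X α) (h : SimpleFunc X β)
    (F : α → β → ℂ) (hF : ∀ x y, F x y ≠ 0 → m (g ⁻¹' {x} ∩ h ⁻¹' {y}) < ∞) :
    ∫ t, F (g t) (h t) ∂m =
      ∑ x ∈ g.range, ∑ y ∈ h.range, F x y * (m.real (g ⁻¹' {x} ∩ h ⁻¹' {y}) : ℂ) := by
  classical
  have hmeas : ∀ x y, MeasurableSet (g ⁻¹' {x} ∩ h ⁻¹' {y}) := fun x y =>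
    (g.measurableSet_fiber x).inter (h.measurableSet_fiber y)
  have hpt : ∀ t, F (g t) (h t) = ∑ x ∈ g.range, ∑ y ∈ h.range,
      (g ⁻¹' {x} ∩ h ⁻¹' {y}).indicator (fun _ => F x y) t := by
    intro t
    rw [Finset.sum_eq_single (g t), Finset.sum_eq_single (h t)]
    · simp
    · intro y _ hy
      simp [hy.symm]
    · intro hn
      exact absurd (h.mem_range_self t) hn
    · intro x _ hx
      exact Finset.sum_eq_zero fun y _ => by simp [hx.symm]
    · intro hn
      exact absurd (g.mem_range_self t) hn
  have hint : ∀ x y, Integrable ((g ⁻¹' {x} ∩ h ⁻¹' {y}).indicator (fun _ => F x y)) m := by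
    intro x y
    by_cases hxy : F x y = 0
    · simp [hxy]
    · exact (integrable_indicator_iff (hmeas x y)).2 (integrableOn_const (hF x y hxy).ne)
  simp_rw [hpt]
  rw [integral_finsetSum _ fun x _ => integrable_finsetSum _ fun y _ => hint x y]
  refine Finset.sum_congr rfl fun x _ => ?_
  rw [integral_finsetSum _ fun y _ => hint x y]
  refine Finset.sum_congr rfl fun y _ => ?_
  rw [integral_indicator_const _ (hmeas x y), Complex.real_smul, mul_comm]

/-- `b` maps sets of finite mass to a Hilbert space, with `⟨b A', b A⟩ = s m(A ∩ A')`. -/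
def IsOrthogonalSetFunction (m : Measure X) (s : ℝ) (b : Set X → H) : Prop :=
  ∀ A A', MeasurableSet A → MeasurableSet A' → m A < ∞ → m A' < ∞ →
    inner ℂ (b A') (b A) = ((s * m.real (A ∩ A') : ℝ) : ℂ)

variable {m : Measure X} {s : ℝ} {b : Set X → H}

/-- The polarised isometry on simple functions. Expanding over the fibres of `g` and `h` needs only
orthogonality, not additivity of `b`. Keeping `e` apart from `g` lets an entry of a matrix valued
function be integrated along the fibres of the whole matrix, as `simpleIntegral` does. -/
theorem inner_scalarIntegral (hb : IsOrthogonalSetFunction m s b) (g : SimpleFunc X α)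
    (h : SimpleFunc X β) (e : α → ℂ) (k : β → ℂ) (hg : ∀ x, e x ≠ 0 → m (g ⁻¹' {x}) < ∞)
    (hh : ∀ y, k y ≠ 0 → m (h ⁻¹' {y}) < ∞) :
    inner ℂ (scalarIntegral b h k) (scalarIntegral b g e) =
      s * ∫ t, e (g t) * conj (k (h t)) ∂m := by
  rw [integral_simpleFunc_pair g h fun x y => e x * conj (k y)]
  · rw [scalarIntegral, scalarIntegral, inner_sum, Finset.mul_sum]
    refine Finset.sum_congr rfl fun x _ => ?_
    rw [sum_inner, Finset.mul_sum]
    refine Finset.sum_congr rfl fun y _ => ?_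
    rw [inner_smul_left, inner_smul_right]
    by_cases hx : e x = 0
    · simp [hx]
    by_cases hy : k y = 0
    · simp [hy]
    rw [hb _ _ (g.measurableSet_fiber x) (h.measurableSet_fiber y) (hg x hx) (hh y hy)]
    push_cast
    ring
  · intro x y hxy
    exact (measure_mono Set.inter_subset_left).trans_lt (hg x (left_ne_zero_of_mul hxy))

theorem memLp_simpleFunc_comp (g : SimpleFunc X α) (e : α → ℂ)
    (hg : ∀ x, e x ≠ 0 → m (g ⁻¹' {x}) < ∞) : MemLp (fun t => e (g t)) 2 m := by
  classical
  have : (fun t => e (g t)) = fun t => ∑ x ∈ g.range, (g ⁻¹' {x}).indicator (fun _ => e x) t := by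
    funext t
    rw [Finset.sum_eq_single (g t)]
    · simp
    · intro x _ hx
      simp [hx.symm]
    · intro hn
      exact absurd (g.mem_range_self t) hn
  rw [this]
  refine memLp_finsetSum _ fun x _ => ?_
  by_cases hx : e x = 0
  · simp [hx]
  · exact memLp_indicator_const _ (g.measurableSet_fiber x) _ (Or.inr (hg x hx).ne)

theorem inner_scalarIntegral_eq_inner_toLp (hb : IsOrthogonalSetFunction m s b)
    (g : SimpleFunc X α) (h : SimpleFunc X β) (e : α → ℂ) (k : β → ℂ)
    (hg : ∀ x, e x ≠ 0 → m (g ⁻¹' {x}) < ∞) (hh : ∀ y, k y ≠ 0 → m (h ⁻¹' {y}) < ∞) :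
    inner ℂ (scalarIntegral b h k) (scalarIntegral b g e) =
      s * inner ℂ ((memLp_simpleFunc_comp h k hh).toLp) ((memLp_simpleFunc_comp g e hg).toLp) := by
  rw [inner_scalarIntegral hb g h e k hg hh, L2.inner_def]
  congr 1
  refine integral_congr_ae ?_
  filter_upwards [(memLp_simpleFunc_comp h k hh).coeFn_toLp,
    (memLp_simpleFunc_comp g e hg).coeFn_toLp] with t h1 h2
  rw [h1, h2, RCLike.inner_apply]

theorem norm_scalarIntegral_sub (hb : IsOrthogonalSetFunction m s b)
    (g : SimpleFunc X α) (h : SimpleFunc X β) (e : α → ℂ) (k : β → ℂ)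
    (hg : ∀ x, e x ≠ 0 → m (g ⁻¹' {x}) < ∞) (hh : ∀ y, k y ≠ 0 → m (h ⁻¹' {y}) < ∞) :
    ‖scalarIntegral b g e - scalarIntegral b h k‖ ^ 2 =
      s * ‖(memLp_simpleFunc_comp g e hg).toLp - (memLp_simpleFunc_comp h k hh).toLp‖ ^ 2 := by
  rw [← Complex.ofReal_inj]
  push_cast
  have h1 := fun v : H => inner_self_eq_norm_sq_to_K (𝕜 := ℂ) v
  have h2 := fun v : Lp ℂ 2 m => inner_self_eq_norm_sq_to_K (𝕜 := ℂ) v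
  simp only [Complex.coe_algebraMap] at h1 h2
  rw [← h1, ← h2]
  simp only [inner_sub_left, inner_sub_right, inner_scalarIntegral_eq_inner_toLp hb _ _ _ _ hg hh,
    inner_scalarIntegral_eq_inner_toLp hb _ _ _ _ hg hg,
    inner_scalarIntegral_eq_inner_toLp hb _ _ _ _ hh hg,
    inner_scalarIntegral_eq_inner_toLp hb _ _ _ _ hh hh]
  ring

theorem exists_tendsto_scalarIntegral [CompleteSpace H] (hb : IsOrthogonalSetFunction m s b)
    (hs : 0 ≤ s) (g : ℕ → SimpleFunc X α) (e : α → ℂ)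
    (hg : ∀ n x, e x ≠ 0 → m (g n ⁻¹' {x}) < ∞) {f : X → ℂ} (hf : MemLp f 2 m)
    (hlim : Tendsto (fun n => eLpNorm (fun t => e (g n t) - f t) 2 m) atTop (𝓝 0)) :
    ∃ J, Tendsto (fun n => scalarIntegral b (g n) e) atTop (𝓝 J) := by
  have hG := (Lp.tendsto_Lp_iff_tendsto_eLpNorm'' (fun n t => e (g n t))
    (fun n => memLp_simpleFunc_comp (g n) e (hg n)) f hf).2 hlim
  refine cauchySeq_tendsto_of_complete (Metric.cauchySeq_iff.2 fun ε hε => ?_)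
  -- The integral scales distances by `√s`; the added `1` keeps the divisor positive when `s = 0`.
  obtain ⟨N, hN⟩ := Metric.cauchySeq_iff.1 hG.cauchySeq (ε / (Real.sqrt s + 1)) (by positivity)
  refine ⟨N, fun i hi j hj => ?_⟩
  have h1 := hN i hi j hj
  rw [dist_eq_norm] at h1 ⊢
  have h2 := norm_scalarIntegral_sub hb (g i) (g j) e e (hg i) (hg j)
  rw [lt_div_iff₀ (by positivity)] at h1
  refine lt_of_le_of_lt ?_ h1
  refine le_of_sq_le_sq ?_ (by positivity)
  rw [h2, mul_pow, mul_comm]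
  gcongr
  nlinarith [Real.sq_sqrt hs, Real.sqrt_nonneg s]

theorem inner_tendsto_scalarIntegral (hb : IsOrthogonalSetFunction m s b)
    (g : ℕ → SimpleFunc X α) (h : ℕ → SimpleFunc X β) (e : α → ℂ) (k : β → ℂ)
    (hg : ∀ n x, e x ≠ 0 → m (g n ⁻¹' {x}) < ∞) (hh : ∀ n x, k x ≠ 0 → m (h n ⁻¹' {x}) < ∞)
    {f f' : X → ℂ} (hf : MemLp f 2 m) (hf' : MemLp f' 2 m)
    (hlim : Tendsto (fun n => eLpNorm (fun t => e (g n t) - f t) 2 m) atTop (𝓝 0))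
    (hlim' : Tendsto (fun n => eLpNorm (fun t => k (h n t) - f' t) 2 m) atTop (𝓝 0))
    {J J' : H} (hJ : Tendsto (fun n => scalarIntegral b (g n) e) atTop (𝓝 J))
    (hJ' : Tendsto (fun n => scalarIntegral b (h n) k) atTop (𝓝 J')) :
    inner ℂ J' J = s * ∫ t, f t * conj (f' t) ∂m := by
  have hG := (Lp.tendsto_Lp_iff_tendsto_eLpNorm'' (fun n t => e (g n t))
    (fun n => memLp_simpleFunc_comp (g n) e (hg n)) f hf).2 hlim
  have hG' := (Lp.tendsto_Lp_iff_tendsto_eLpNorm'' (fun n t => k (h n t))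
    (fun n => memLp_simpleFunc_comp (h n) k (hh n)) f' hf').2 hlim'
  have h1 := hJ'.inner (𝕜 := ℂ) hJ
  have h2 := (hG'.inner (𝕜 := ℂ) hG).const_mul (s : ℂ)
  simp only [inner_scalarIntegral_eq_inner_toLp hb _ _ _ _ (hg _) (hh _)] at h1
  rw [tendsto_nhds_unique h1 h2, L2.inner_def]
  congr 1
  refine integral_congr_ae ?_
  filter_upwards [hf.coeFn_toLp, hf'.coeFn_toLp] with t h1 h2
  rw [h1, h2, RCLike.inner_apply]

end OrthogonalSetFunction

/-! ### Coordinates of square integrable random vectors -/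

section Coordinates

variable {p : ℕ} {Ω : Type*} [MeasurableSpace Ω] {P : Measure Ω}

/-- The `i`-th coordinate of a square integrable random vector. -/
def coordLp (P : Measure Ω) (i : Fin p) : Lp (EuclideanSpace ℂ (Fin p)) 2 P →L[ℂ] Lp ℂ 2 P :=
  (EuclideanSpace.proj i : EuclideanSpace ℂ (Fin p) →L[ℂ] ℂ).compLpL 2 P

/-- The random vector with `i`-th coordinate given and the other coordinates `0`. -/
def embedLp (P : Measure Ω) (i : Fin p) : Lp ℂ 2 P →L[ℂ] Lp (EuclideanSpace ℂ (Fin p)) 2 P :=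
  (ContinuousLinearMap.toSpanSingleton ℂ (EuclideanSpace.single i (1 : ℂ))).compLpL 2 P

theorem coeFn_coordLp (i : Fin p) (F : Lp (EuclideanSpace ℂ (Fin p)) 2 P) :
    coordLp P i F =ᵐ[P] fun ω => F ω i :=
  ContinuousLinearMap.coeFn_compLpL _ _

theorem coeFn_embedLp (i : Fin p) (F : Lp ℂ 2 P) :
    embedLp P i F =ᵐ[P] fun ω => F ω • EuclideanSpace.single i (1 : ℂ) :=
  ContinuousLinearMap.coeFn_compLpL _ _

theorem sum_embedLp_coordLp (F : Lp (EuclideanSpace ℂ (Fin p)) 2 P) :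
    ∑ i, embedLp P i (coordLp P i F) = F := by
  refine Lp.ext ?_
  have h1 : ∀ᵐ ω ∂P, ∀ i, coordLp P i F ω = F ω i := ae_all_iff.2 fun i => coeFn_coordLp i F
  have h2 : ∀ᵐ ω ∂P, ∀ i, embedLp P i (coordLp P i F) ω =
      coordLp P i F ω • EuclideanSpace.single i (1 : ℂ) := ae_all_iff.2 fun i => coeFn_embedLp i _
  filter_upwards [h1, h2, Lp.coeFn_finsetSum Finset.univ fun i => embedLp P i (coordLp P i F)]
    with ω h1 h2 h3
  rw [h3, Finset.sum_apply]
  ext j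
  simp [h1, h2, Finset.sum_apply, Pi.single_apply]

theorem coordLp_compLp (a : Matrix (Fin p) (Fin p) ℂ) (i : Fin p)
    (F : Lp (EuclideanSpace ℂ (Fin p)) 2 P) :
    coordLp P i ((Matrix.toEuclideanCLM (n := Fin p) (𝕜 := ℂ) a).compLp F) =
      ∑ k, a i k • coordLp P k F := by
  refine Lp.ext ?_
  have h1 : ∀ᵐ ω ∂P, ∀ k, coordLp P k F ω = F ω k := ae_all_iff.2 fun i => coeFn_coordLp i F
  have h2 : ∀ᵐ ω ∂P, ∀ k, (a i k • coordLp P k F : Lp ℂ 2 P) ω = a i k • coordLp P k F ω :=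
    ae_all_iff.2 fun k => Lp.coeFn_smul _ _
  filter_upwards [h1, h2, Lp.coeFn_finsetSum Finset.univ fun k => a i k • coordLp P k F,
    coeFn_coordLp i ((Matrix.toEuclideanCLM (n := Fin p) (𝕜 := ℂ) a).compLp F),
    (Matrix.toEuclideanCLM (n := Fin p) (𝕜 := ℂ) a).coeFn_compLp F] with ω h1 h2 h3 h4 h5
  rw [h4, h5, h3, Finset.sum_apply]
  simp [h1, h2, Matrix.mulVec, dotProduct]

theorem coordLp_simpleIntegral {d : ℕ} (B : Set (Polar d) → Lp (EuclideanSpace ℂ (Fin p)) 2 P)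
    (g : SimpleFunc (Polar d) (Matrix (Fin p) (Fin p) ℂ)) (i : Fin p) :
    coordLp P i (simpleIntegral B g) =
      ∑ k, scalarIntegral (fun A => coordLp P k (B A)) g fun a => a i k := by
  simp only [simpleIntegral, scalarIntegral, map_sum, coordLp_compLp]
  exact Finset.sum_comm

theorem inner_coordLp (i j : Fin p) (F G : Lp (EuclideanSpace ℂ (Fin p)) 2 P) :
    inner ℂ (coordLp P j G) (coordLp P i F) = ∫ ω, F ω i * conj (G ω j) ∂P := by
  rw [L2.inner_def]
  refine integral_congr_ae ?_
  filter_upwards [coeFn_coordLp i F, coeFn_coordLp j G] with ω h1 h2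
  rw [h1, h2, RCLike.inner_apply]

end Coordinates

/-! ### The stochastic integral for a control measure with uniform diagonal -/

section Integral

variable {d p : ℕ} {Ω : Type*} [MeasurableSpace Ω] {P : Measure Ω}
  {μ : DirectionalMeasure d p} {σ : Fin p → ℝ}
  {B : Set (Polar d) → Lp (EuclideanSpace ℂ (Fin p)) 2 P}

/-- The diagonal of `μ` is `σ_jj dθ`. -/
def HasUniformDiagonal (μ : DirectionalMeasure d p) (σ : Fin p → ℝ) : Prop :=
  ∀ j, ∀ A : Set (Sphere d), MeasurableSet A →
    μ.toVectorMeasure A j j = ((σ j * (surfaceMeasure d).real A : ℝ) : ℂ)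

theorem finiteMass_of_polarMeasure_lt_top (hσ : ∀ j, 0 < σ j) (hμ : HasUniformDiagonal μ σ)
    {A : Set (Polar d)} (hA : MeasurableSet A) (h : polarMeasure d A < ∞) : μ.FiniteMass A := by
  refine ⟨hA, ?_⟩
  rw [controlMass_eq_smul hσ hμ]
  exact ENNReal.mul_lt_top ENNReal.ofReal_lt_top h

/-- Only the `(k, k)` entry of the control measure enters, so each coordinate of `B` falls under the
scalar theory separately. -/
theorem isOrthogonalSetFunction_coordLp (hσ : ∀ j, 0 < σ j) (hμ : HasUniformDiagonal μ σ)
    (hB : IsRandomMeasure μ P B) (k : Fin p) :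
    IsOrthogonalSetFunction (polarMeasure d) (σ k) fun A => coordLp P k (B A) := by
  intro A A' hA hA' hm hm'
  rw [inner_coordLp, hB.orthogonal A A' (finiteMass_of_polarMeasure_lt_top hσ hμ hA hm)
    (finiteMass_of_polarMeasure_lt_top hσ hμ hA' hm'), control_diag hμ (hA.inter hA')]

theorem polarMeasure_lt_top_of_controlMass (hσ : ∀ j, 0 < σ j) (hμ : HasUniformDiagonal μ σ)
    (i : Fin p) {A : Set (Polar d)} (h : μ.controlMass A < ∞) : polarMeasure d A < ∞ := by
  have hpos : 0 < ∑ j, σ j := Finset.sum_pos (fun j _ => hσ j) ⟨i, Finset.mem_univ i⟩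
  rw [controlMass_eq_smul hσ hμ, Measure.smul_apply, smul_eq_mul] at h
  exact ENNReal.lt_top_of_mul_ne_top_right h.ne (ENNReal.ofReal_pos.2 hpos).ne'

theorem polarMeasure_fiber_lt_top (hσ : ∀ j, 0 < σ j) (hμ : HasUniformDiagonal μ σ)
    {g : SimpleFunc (Polar d) (Matrix (Fin p) (Fin p) ℂ)}
    (hg : μ.controlMass (Function.support g) < ∞) (i k : Fin p)
    (a : Matrix (Fin p) (Fin p) ℂ) (ha : a i k ≠ 0) : polarMeasure d (g ⁻¹' {a}) < ∞ := by
  refine (measure_mono fun x hx => ?_).trans_lt (polarMeasure_lt_top_of_controlMass hσ hμ i hg)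
  rw [Function.mem_support, hx]
  rintro rfl
  exact ha rfl

theorem eLpNorm_two_eq {X : Type*} [MeasurableSpace X] (m : Measure X) {E : Type*}
    [NormedAddCommGroup E] (f : X → E) :
    eLpNorm f 2 m = (∫⁻ x, ‖f x‖ₑ ^ 2 ∂m) ^ (1 / 2 : ℝ) := by
  rw [eLpNorm_eq_lintegral_rpow_enorm_toReal two_ne_zero ENNReal.ofNat_ne_top]
  simp

theorem tendsto_eLpNorm_entry (hσ : ∀ j, 0 < σ j) (hμ : HasUniformDiagonal μ σ)
    {F : ℕ → Polar d → Matrix (Fin p) (Fin p) ℂ}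
    (h : Tendsto (fun n => sqNorm μ (F n)) atTop (𝓝 0)) (i k : Fin p) :
    Tendsto (fun n => eLpNorm (fun x => F n x i k) 2 (polarMeasure d)) atTop (𝓝 0) := by
  have hpos : 0 < ∑ j, σ j := Finset.sum_pos (fun j _ => hσ j) ⟨i, Finset.mem_univ i⟩
  set C := ENNReal.ofReal (∑ j, σ j)
  have hC : C ≠ 0 := (ENNReal.ofReal_pos.2 hpos).ne'
  have hCt : C ≠ ∞ := ENNReal.ofReal_ne_top
  have h1 : Tendsto (fun n => ∫⁻ x, ‖F n x i k‖ₑ ^ 2 ∂polarMeasure d) atTop (𝓝 0) := by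
    have h2 : Tendsto (fun n => C⁻¹ * sqNorm μ (F n)) atTop (𝓝 0) := by
      simpa using ENNReal.Tendsto.const_mul h (Or.inr (ENNReal.inv_ne_top.2 hC))
    refine tendsto_of_tendsto_of_tendsto_of_le_of_le tendsto_const_nhds h2
      (fun _ => zero_le) fun n => ?_
    rw [sqNorm, controlMass_eq_smul hσ hμ, lintegral_smul_measure, smul_eq_mul, ← mul_assoc,
      ENNReal.inv_mul_cancel hC hCt, one_mul]
    refine lintegral_mono fun x => ?_
    exact (Finset.single_le_sum (f := fun k => ‖F n x i k‖ₑ ^ 2) (fun _ _ => zero_le)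
      (Finset.mem_univ k)).trans (Finset.single_le_sum (f := fun i => ∑ k, ‖F n x i k‖ₑ ^ 2)
        (fun _ _ => zero_le) (Finset.mem_univ i))
  simp_rw [eLpNorm_two_eq]
  simpa [Function.comp_def] using
    ((ENNReal.continuous_rpow_const (y := (1 / 2 : ℝ))).tendsto 0).comp h1

theorem sqNorm_le_of_pi (hσ : ∀ j, 0 < σ j) (hμ : HasUniformDiagonal μ σ)
    (F : Polar d → Fin p → Fin p → ℂ) :
    sqNorm μ (fun x => Matrix.of (F x)) ≤
      ENNReal.ofReal (∑ j, σ j) * (p * (p * eLpNorm F 2 (polarMeasure d) ^ 2)) := by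
  rw [sqNorm, controlMass_eq_smul hσ hμ, lintegral_smul_measure, smul_eq_mul]
  gcongr
  rw [eLpNorm_two_eq, ← ENNReal.rpow_natCast, ← ENNReal.rpow_mul]
  norm_num
  rw [← lintegral_const_mul' _ _ (ENNReal.natCast_ne_top p),
    ← lintegral_const_mul' _ _ (ENNReal.natCast_ne_top p)]
  refine lintegral_mono fun x => ?_
  have : ∀ j k, ‖F x j k‖ₑ ^ 2 ≤ ‖F x‖ₑ ^ 2 := fun j k => by
    gcongr
    exact (enorm_le_iff_norm_le.2 (norm_le_pi_norm (F x j) k)).trans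
      (enorm_le_iff_norm_le.2 (norm_le_pi_norm (F x) j))
  calc ∑ j, ∑ k, ‖F x j k‖ₑ ^ 2 ≤ ∑ _j : Fin p, ∑ _k : Fin p, ‖F x‖ₑ ^ 2 :=
        Finset.sum_le_sum fun j _ => Finset.sum_le_sum fun k _ => this j k
    _ = p * (p * ‖F x‖ₑ ^ 2) := by simp

/-- Every square integrable Borel function has a stochastic integral. -/
theorem exists_isStochasticIntegral (hσ : ∀ j, 0 < σ j) (hμ : HasUniformDiagonal μ σ)
    (hB : IsRandomMeasure μ P B) (f : Polar d → Matrix (Fin p) (Fin p) ℂ)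
    (hfm : ∀ j k, Measurable fun x => f x j k)
    (hf : ∀ j k, MemLp (fun x => f x j k) 2 (polarMeasure d)) :
    ∃ J, IsStochasticIntegral μ B f J := by
  -- The approximation is carried out in the sup norm of `Fin p → Fin p → ℂ`; `sqNorm_le_of_pi`
  -- converts it to `sqNorm` at the cost of a factor `p²`.
  let f' : Polar d → Fin p → Fin p → ℂ := fun x j k => f x j k
  have hf'm : Measurable f' := measurable_pi_lambda _ fun j => measurable_pi_lambda _ fun k => hfm j k
  have hf' : MemLp f' 2 (polarMeasure d) := memLp_pi_iff.2 fun j => memLp_pi_iff.2 fun k => hf j k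
  let g' := fun n => SimpleFunc.approxOn f' hf'm (Set.range f' ∪ {0}) 0 (by simp) n
  have hg'lim : Tendsto (fun n => eLpNorm (⇑(g' n) - f') 2 (polarMeasure d)) atTop (𝓝 0) :=
    SimpleFunc.tendsto_approxOn_range_Lp_eLpNorm ENNReal.ofNat_ne_top hf'm hf'.2
  have hg'mem : ∀ n, MemLp (g' n) 2 (polarMeasure d) := SimpleFunc.memLp_approxOn_range hf'm hf'
  let g : ℕ → SimpleFunc (Polar d) (Matrix (Fin p) (Fin p) ℂ) := fun n => (g' n).map Matrix.of
  have hfin : sqNorm μ f < ∞ := by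
    refine (sqNorm_le_of_pi hσ hμ f').trans_lt ?_
    exact ENNReal.mul_lt_top ENNReal.ofReal_lt_top (ENNReal.mul_lt_top (ENNReal.natCast_lt_top p)
      (ENNReal.mul_lt_top (ENNReal.natCast_lt_top p) (ENNReal.pow_lt_top hf'.2)))
  have hsupp : ∀ n, μ.controlMass (Function.support (g n)) < ∞ := by
    intro n
    have h1 := (g' n).measure_support_lt_top_of_memLp (hg'mem n) two_ne_zero ENNReal.ofNat_ne_top
    have h2 : Function.support (g n) = Function.support (g' n) := by
      rfl
    rw [h2]
    exact (finiteMass_of_polarMeasure_lt_top hσ hμ (g' n).measurableSet_support h1).2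
  have hlim : Tendsto (fun n => sqNorm μ fun x => g n x - f x) atTop (𝓝 0) := by
    have h1 : Tendsto (fun n => ENNReal.ofReal (∑ j, σ j) * (p * (p *
        eLpNorm (⇑(g' n) - f') 2 (polarMeasure d) ^ 2))) atTop (𝓝 0) := by
      have h2 := ((ENNReal.continuous_pow 2).tendsto 0).comp hg'lim
      have h3 := ENNReal.Tendsto.const_mul h2 (Or.inr (ENNReal.natCast_ne_top p))
      have h4 := ENNReal.Tendsto.const_mul h3 (Or.inr (ENNReal.natCast_ne_top p))
      have h5 := ENNReal.Tendsto.const_mul h4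
        (Or.inr (ENNReal.ofReal_ne_top (r := ∑ j, σ j)))
      simpa using h5
    exact tendsto_of_tendsto_of_tendsto_of_le_of_le tendsto_const_nhds h1 (fun _ => zero_le)
      fun n => sqNorm_le_of_pi hσ hμ (⇑(g' n) - f')
  have hentry : ∀ i k, ∃ J, Tendsto (fun n => scalarIntegral (fun A => coordLp P k (B A)) (g n)
      fun a => a i k) atTop (𝓝 J) := fun i k =>
    exists_tendsto_scalarIntegral (isOrthogonalSetFunction_coordLp hσ hμ hB k) (hσ k).le g _
      (fun n a ha => polarMeasure_fiber_lt_top hσ hμ (hsupp n) i k a ha) (hf i k)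
      (tendsto_eLpNorm_entry hσ hμ hlim i k)
  choose J hJ using hentry
  refine ⟨∑ i, embedLp P i (∑ k, J i k), hfm, hfin, g, hsupp, hlim, ?_⟩
  have h1 : ∀ n, simpleIntegral B (g n) = ∑ i, embedLp P i
      (∑ k, scalarIntegral (fun A => coordLp P k (B A)) (g n) fun a => a i k) := fun n => by
    simp_rw [← coordLp_simpleIntegral]
    exact (sum_embedLp_coordLp _).symm
  simp_rw [h1]
  exact tendsto_finsetSum _ fun i _ => ((embedLp P i).continuous.tendsto _).comp
    (tendsto_finsetSum _ fun k _ => hJ i k)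

/-- The coordinates of the integral of a diagonal function are limits of scalar integrals. -/
theorem IsStochasticIntegral.exists_tendsto_coordLp (hσ : ∀ j, 0 < σ j)
    (hμ : HasUniformDiagonal μ σ) (hB : IsRandomMeasure μ P B)
    {f : Polar d → Matrix (Fin p) (Fin p) ℂ} {J : Lp (EuclideanSpace ℂ (Fin p)) 2 P}
    (hJ : IsStochasticIntegral μ B f J)
    (hf : ∀ j k, MemLp (fun x => f x j k) 2 (polarMeasure d))
    (hdiag : ∀ x j k, j ≠ k → f x j k = 0) (i : Fin p) :
    ∃ g : ℕ → SimpleFunc (Polar d) (Matrix (Fin p) (Fin p) ℂ),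
      (∀ n, μ.controlMass (Function.support (g n)) < ∞) ∧
      Tendsto (fun n => eLpNorm (fun x => g n x i i - f x i i) 2 (polarMeasure d)) atTop (𝓝 0) ∧
      Tendsto (fun n => scalarIntegral (fun A => coordLp P i (B A)) (g n) fun a => a i i)
        atTop (𝓝 (coordLp P i J)) := by
  obtain ⟨-, -, g, hsupp, hlim, hgJ⟩ := hJ
  have hl := fun k => tendsto_eLpNorm_entry hσ hμ hlim i k
  have horth := isOrthogonalSetFunction_coordLp hσ hμ hB
  have hfib := fun k n a ha => polarMeasure_fiber_lt_top hσ hμ (hsupp n) i k a ha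
  have hentry : ∀ k, ∃ J, Tendsto (fun n => scalarIntegral (fun A => coordLp P k (B A)) (g n)
      fun a => a i k) atTop (𝓝 J) := fun k =>
    exists_tendsto_scalarIntegral (horth k) (hσ k).le g _ (hfib k) (hf i k) (hl k)
  choose K hK using hentry
  -- The approximants `g n` need not be diagonal, but by the isometry the limit has squared norm
  -- `σ_k ∫ |f_ik|² = 0`.
  have hzero : ∀ k, k ≠ i → K k = 0 := by
    intro k hk
    have h := inner_tendsto_scalarIntegral (horth k) g g _ _ (hfib k) (hfib k) (hf i k) (hf i k)
      (hl k) (hl k) (hK k) (hK k)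
    simpa [hdiag _ i k hk.symm] using h
  refine ⟨g, hsupp, hl i, ?_⟩
  have h1 := ((coordLp P i).continuous.tendsto _).comp hgJ
  simp only [Function.comp_def, coordLp_simpleIntegral] at h1
  have h2 := tendsto_nhds_unique h1 (tendsto_finsetSum Finset.univ fun k _ => hK k)
  rw [h2, Finset.sum_eq_single i (fun k _ hk => hzero k hk) (by simp)]
  exact hK i

theorem IsStochasticIntegral.integral_mul_conj (hσ : ∀ j, 0 < σ j)
    (hμ : HasUniformDiagonal μ σ) (hB : IsRandomMeasure μ P B)
    {f f' : Polar d → Matrix (Fin p) (Fin p) ℂ} {J J' : Lp (EuclideanSpace ℂ (Fin p)) 2 P}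
    (hJ : IsStochasticIntegral μ B f J) (hJ' : IsStochasticIntegral μ B f' J')
    (hf : ∀ j k, MemLp (fun x => f x j k) 2 (polarMeasure d))
    (hf' : ∀ j k, MemLp (fun x => f' x j k) 2 (polarMeasure d))
    (hdiag : ∀ x j k, j ≠ k → f x j k = 0) (hdiag' : ∀ x j k, j ≠ k → f' x j k = 0)
    (i : Fin p) :
    ∫ ω, J ω i * conj (J' ω i) ∂P = σ i * ∫ x, f x i i * conj (f' x i i) ∂polarMeasure d := by
  obtain ⟨g, hg, hl, hgJ⟩ := hJ.exists_tendsto_coordLp hσ hμ hB hf hdiag i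
  obtain ⟨g', hg', hl', hgJ'⟩ := hJ'.exists_tendsto_coordLp hσ hμ hB hf' hdiag' i
  rw [← inner_coordLp]
  exact inner_tendsto_scalarIntegral (isOrthogonalSetFunction_coordLp hσ hμ hB i) g g' _ _
    (fun n a ha => polarMeasure_fiber_lt_top hσ hμ (hg n) i i a ha)
    (fun n a ha => polarMeasure_fiber_lt_top hσ hμ (hg' n) i i a ha) (hf i i) (hf' i i)
    hl hl' hgJ hgJ'

theorem IsStochasticIntegral.integral_eq_zero [IsFiniteMeasure P]
    (hB : IsRandomMeasure μ P B)
    {f : Polar d → Matrix (Fin p) (Fin p) ℂ} {J : Lp (EuclideanSpace ℂ (Fin p)) 2 P}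
    (hJ : IsStochasticIntegral μ B f J) (i : Fin p) : ∫ ω, J ω i ∂P = 0 := by
  obtain ⟨-, -, g, hsupp, -, hgJ⟩ := hJ
  -- The mean is the inner product with the constant `1`, hence continuous in L², so it suffices
  -- that simple integrals have mean zero.
  let u : Lp ℂ 2 P := (memLp_const (1 : ℂ)).toLp
  have hu : ∀ (F : Lp (EuclideanSpace ℂ (Fin p)) 2 P) (k : Fin p),
      inner ℂ u (coordLp P k F) = ∫ ω, F ω k ∂P := by
    intro F k
    rw [L2.inner_def]
    refine integral_congr_ae ?_
    filter_upwards [coeFn_coordLp k F, (memLp_const (μ := P) (p := 2) (1 : ℂ)).coeFn_toLp]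
      with ω h1 h2
    rw [h1, h2, RCLike.inner_apply]
    simp
  have hBk : ∀ A, μ.FiniteMass A → ∀ k, inner ℂ u (coordLp P k (B A)) = 0 := by
    intro A hA k
    have hint : Integrable (B A) P := (Lp.memLp (B A)).integrable one_le_two
    have h1 := (EuclideanSpace.proj k : EuclideanSpace ℂ (Fin p) →L[ℂ] ℂ).integral_comp_comm hint
    rw [hB.zero_mean A hA, map_zero] at h1
    rw [hu]
    exact h1
  have hg : ∀ n, inner ℂ u (coordLp P i (simpleIntegral B (g n))) = 0 := by
    intro n
    rw [coordLp_simpleIntegral, inner_sum]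
    refine Finset.sum_eq_zero fun k _ => ?_
    rw [scalarIntegral, inner_sum]
    refine Finset.sum_eq_zero fun a _ => ?_
    rw [inner_smul_right]
    -- The fibre over the zero matrix may have infinite mass, where nothing is known about `B`; its
    -- coefficient vanishes.
    by_cases ha : a i k = 0
    · rw [ha, zero_mul]
    · rw [hBk, mul_zero]
      refine ⟨(g n).measurableSet_fiber a, (measure_mono fun x hx => ?_).trans_lt (hsupp n)⟩
      rw [Function.mem_support, hx]
      rintro rfl
      exact ha rfl
  have h1 : Tendsto (fun n => inner ℂ u (coordLp P i (simpleIntegral B (g n)))) atTop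
      (𝓝 (inner ℂ u (coordLp P i J))) :=
    tendsto_const_nhds.inner (((coordLp P i).continuous.tendsto _).comp hgJ)
  simp only [hg] at h1
  rw [← hu, tendsto_nhds_unique tendsto_const_nhds h1]

theorem isStochasticIntegral_stochasticIntegral {f : Polar d → Matrix (Fin p) (Fin p) ℂ}
    (h : ∃ J, IsStochasticIntegral μ B f J) :
    IsStochasticIntegral μ B f (stochasticIntegral μ B f) := by
  rw [stochasticIntegral, dif_pos h]
  exact h.choose_spec

end Integral

/-! ### Transfer along equality of finite-dimensional distributions -/

/-- All three properties are determined by the joint laws at `{s, t}`, where `s = t` is allowed and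
gives the one-point laws. -/
theorem HasMaternCovariance.of_eqFDD {d p : ℕ} {Ω Ω' : Type*} [MeasurableSpace Ω]
    [MeasurableSpace Ω'] {P : Measure Ω} {P' : Measure Ω'}
    {Y : Space d → Ω' → EuclideanSpace ℂ (Fin p)} {X : Space d → Ω → EuclideanSpace ℂ (Fin p)}
    (h : EqFDD P' P Y X) {j : Fin p} {a ν v : ℝ}
    (hX : HasMaternCovariance P (fun s ω => X s ω j) a ν v) :
    HasMaternCovariance P' (fun s ω => Y s ω j) a ν v := by
  classical
  have hpair : ∀ s t, IdentDistrib (fun ω => (Y s ω j, Y t ω j)) (fun ω => (X s ω j, X t ω j))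
      P' P := by
    intro s t
    refine (h {s, t}).comp (u := fun z : ({s, t} : Finset (Space d)) → EuclideanSpace ℂ (Fin p) =>
      (z ⟨s, by simp⟩ j, z ⟨t, by simp⟩ j)) ?_
    fun_prop
  have hone : ∀ s, IdentDistrib (fun ω => Y s ω j) (fun ω => X s ω j) P' P := fun s =>
    (hpair s s).comp measurable_fst
  refine ⟨fun s => (hone s).memLp_iff.2 (hX.1 s), fun s => ?_, fun s t => ?_⟩
  · rw [(hone s).integral_eq]
    exact hX.2.1 s
  · rw [← hX.2.2 s t]
    exact ((hpair s t).comp (u := fun z : ℂ × ℂ => z.1 * conj z.2)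
      (measurable_fst.mul (Complex.continuous_conj.measurable.comp measurable_snd))).integral_eq

/-! ### Square integrability of the integrand and assembly of the proof -/

theorem memLp_maternEntry {d : ℕ} {a ν : ℝ} (hν : 0 < ν) (c : ℝ) (ha : 0 < a)
    (φ : Sphere d → ℝ) (hφ_meas : Measurable φ) (hφ : ∀ θ, φ θ = 1 ∨ φ θ = -1) (s : Space d) :
    MemLp (maternEntry a ν c φ s) 2 (polarMeasure d) := by
  refine (memLp_two_iff_integrable_sq_norm
    (measurable_maternEntry a ν c φ hφ_meas s).aestronglyMeasurable).2 ?_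
  -- At lag `s - s` the product formula is the squared modulus of the entry, so integrability of the
  -- spectral density is what is needed.
  have h := (integrable_polarMeasure ((integrable_maternSpectral hν ha
    (s - s)).const_mul ((c ^ 2 : ℝ) : ℂ))).norm
  refine h.congr (Eventually.of_forall fun x => ?_)
  simp only
  rw [← maternEntry_mul_conj ν c ha φ hφ s s x, norm_mul, Complex.norm_conj, sq]

theorem hasMaternCovariance_of_isMaternProcess {d p : ℕ} (hd : 1 ≤ d)
    {Ω Ω' : Type*} [MeasurableSpace Ω] [MeasurableSpace Ω']
    (P : Measure Ω) [IsProbabilityMeasure P] (P' : Measure Ω') [IsProbabilityMeasure P']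
    (a ν c σ : Fin p → ℝ) (ha : ∀ j, 0 < a j) (hν : ∀ j, 0 < ν j) (hσ : ∀ j, 0 < σ j)
    (φ : Sphere d → ℝ) (hφ_meas : Measurable φ)
    (hφ_sign : ∀ θ, φ θ = 1 ∨ φ θ = -1)
    (μ : DirectionalMeasure d p)
    (hμ : ∀ j, ∀ A : Set (Sphere d), MeasurableSet A →
      μ.toVectorMeasure A j j = ((σ j * (surfaceMeasure d).real A : ℝ) : ℂ))
    (hc : ∀ j, c j = a j ^ ν j * Real.sqrt (Real.Gamma (ν j + d / 2)) /
      (Real.pi ^ ((d : ℝ) / 4) * Real.sqrt (Real.Gamma (ν j))))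
    (B : Set (Polar d) → Lp (EuclideanSpace ℂ (Fin p)) 2 P)
    (hB : IsRandomMeasure μ P B)
    (Y : Space d → Ω' → EuclideanSpace ℂ (Fin p))
    (hY : IsMaternProcess μ a ν c φ P B P' Y) :
    ∀ j, HasMaternCovariance P' (fun s ω => Y s ω j) (a j) (ν j) (σ j) := by
  intro j
  refine HasMaternCovariance.of_eqFDD hY ?_
  have hμ' : HasUniformDiagonal μ σ := hμ
  set f : Space d → Polar d → Matrix (Fin p) (Fin p) ℂ := fun s => maternIntegrand a ν c φ s
  have hf : ∀ s x, f s x = Matrix.diagonal fun j => maternEntry (a j) (ν j) (c j) φ s x :=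
    fun s x => maternIntegrand_eq_diagonal a ν c ha φ s x
  have hdiag : ∀ s x i k, i ≠ k → f s x i k = 0 := fun s x i k hik => by
    rw [hf, Matrix.diagonal_apply_ne _ hik]
  have hentry : ∀ s i, (fun x => f s x i i) = maternEntry (a i) (ν i) (c i) φ s := fun s i => by
    funext x
    rw [hf, Matrix.diagonal_apply_eq]
  have hmeas : ∀ s i k, Measurable fun x => f s x i k := by
    intro s i k
    by_cases hik : i = k
    · subst hik
      rw [hentry]
      exact measurable_maternEntry _ _ _ φ hφ_meas s
    · simp only [hdiag s _ i k hik, measurable_const]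
  have hmem : ∀ s i k, MemLp (fun x => f s x i k) 2 (polarMeasure d) := by
    intro s i k
    by_cases hik : i = k
    · subst hik
      rw [hentry]
      exact memLp_maternEntry (hν i) _ (ha i) φ hφ_meas hφ_sign s
    · simp only [hdiag s _ i k hik]
      exact MemLp.zero
  -- Existence rules out the default value `0`. The moment identities hold for any L² limit, so the
  -- choice made in `stochasticIntegral` does not matter.
  have hJ : ∀ s, IsStochasticIntegral μ B (f s) (stochasticIntegral μ B (f s)) := fun s =>
    isStochasticIntegral_stochasticIntegral
      (exists_isStochasticIntegral hσ hμ' hB (f s) (hmeas s) (hmem s))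
  refine ⟨fun s => (memLp_piLp_iff.1 (Lp.memLp (stochasticIntegral μ B (f s)))) j,
    fun s => (hJ s).integral_eq_zero hB j, fun s t => ?_⟩
  rw [(hJ s).integral_mul_conj hσ hμ' hB (hJ t) (hmem s) (hmem t) (hdiag s) (hdiag t) j,
    ← integral_maternSpectral_eq_maternCov (hν j) (ha j) (hc j) (σ j) (s - t),
    ← integral_polarMeasure hd]
  congr 1
  refine integral_congr_ae (Filter.Eventually.of_forall fun x => ?_)
  simp only [hf, Matrix.diagonal_apply_eq]
  exact maternEntry_mul_conj (ν j) (c j) (ha j) φ hφ_sign s t x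

end MaternField

end

theorem proposition4p1 {d p : ℕ} (hd : 1 ≤ d)
    {Ω Ω' : Type*} [MeasurableSpace Ω] [MeasurableSpace Ω']
    (P : Measure Ω) [IsProbabilityMeasure P] (P' : Measure Ω') [IsProbabilityMeasure P']
    (a ν c σ : Fin p → ℝ) (ha : ∀ j, 0 < a j) (hν : ∀ j, 0 < ν j) (hσ : ∀ j, 0 < σ j)
    (φ : MaternField.Sphere d → ℝ) (hφ_meas : Measurable φ)
    (hφ_sign : ∀ θ, φ θ = 1 ∨ φ θ = -1) (hφ_odd : ∀ θ, φ (-θ) = -φ θ)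
    (μ : MaternField.DirectionalMeasure d p)
    (hμ : ∀ j, ∀ A : Set (MaternField.Sphere d), MeasurableSet A →
      μ.toVectorMeasure A j j = ((σ j * (MaternField.surfaceMeasure d).real A : ℝ) : ℂ))
    (hc : ∀ j, c j = a j ^ ν j * Real.sqrt (Real.Gamma (ν j + d / 2)) /
      (Real.pi ^ ((d : ℝ) / 4) * Real.sqrt (Real.Gamma (ν j))))
    (B : Set (MaternField.Polar d) → Lp (EuclideanSpace ℂ (Fin p)) 2 P)
    (hB : MaternField.IsRandomMeasure μ P B)
    (Y : MaternField.Space d → Ω' → EuclideanSpace ℂ (Fin p))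
    (hY : MaternField.IsMaternProcess μ a ν c φ P B P' Y) :
    ∀ j, MaternField.HasMaternCovariance P' (fun s ω => Y s ω j) (a j) (ν j) (σ j) :=
  MaternField.hasMaternCovariance_of_isMaternProcess hd P P' a ν c σ ha hν hσ φ hφ_meas hφ_sign
    μ hμ hc B hB Y hY
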